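/- An $n\times n$ image is a matrix $M\in\{0,1\}^{n\times n}$ of pixel values ($1$ = black, $0$ = white). Its image graph has the black pixels as vertices, and $(i,j)$, $(i',j')$ are adjacent iff $|i-i'|+|j-j'|=1$; the image is connected if its image graph is connected (and nonempty). An image is $\varepsilon$-far from connected if at least $\varepsilon n^2$ pixels have to be changed to make it connected. A nonadaptive algorithm chooses (possibly at random) the set of pixels that it queries before receiving any answers, and then accepts or rejects on the basis of the answers (and its coins). It is a 1-sided error $\varepsilon$-tester for connectedness of $n\times n$ images if it accepts every connected image with probability $1$ and rejects every image that is $\varepsilon$-far from connected with probability at least $2/3$. **Theorem.** There are absolute constants $c>0$ and $\varepsilon_0\in(0,1)$ such that for all $\varepsilon\in(0,\varepsilon_0]$ and all integers $n>\frac1{16}\left(\frac1\varepsilon\right)^{5/8}$, every nonadaptive, 1-sided error $\varepsilon$-tester for connectedness of $n\times n$ images that always queries at most $q$ pixels satisfies $$q\;\ge\; c\cdot\frac1\varepsilon\log_2\frac1\varepsilon .$$ -/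

import Mathlib

namespace ImageTesting

/-- A pixel of an `n × n` image. -/
abbrev Pixel (n : ℕ) : Type := Fin n × Fin n

/-- A black-and-white `n × n` image; `true` is black (1), `false` is white (0). -/
abbrev Image (n : ℕ) : Type := Pixel n → Bool

/-- The image graph: its vertices are the black pixels, and `(i, j)`, `(i', j')` are adjacent
iff `|i - i'| + |j - j'| = 1`. -/
def imageGraph {n : ℕ} (M : Image n) : SimpleGraph {p : Pixel n // M p = true} where
  Adj p p' :=
    |((p.1.1 : ℕ) : ℤ) - ((p'.1.1 : ℕ) : ℤ)| + |((p.1.2 : ℕ) : ℤ) - ((p'.1.2 : ℕ) : ℤ)| = 1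
  symm := ⟨fun p p' h => by
    rw [abs_sub_comm ((p'.1.1 : ℕ) : ℤ), abs_sub_comm ((p'.1.2 : ℕ) : ℤ)]; exact h⟩
  loopless := ⟨fun p h => by simp at h⟩

/-- The property of being connected: the set of images whose image graph is connected. -/
def connectedImages (n : ℕ) : Set (Image n) := {M | (imageGraph M).Connected}

/-- `M` is `ε`-far from the property `P`: at least `ε * n ^ 2` pixels of `M` have to be modified
to obtain an image in `P`. -/
def IsFar {n : ℕ} (ε : ℝ) (P : Set (Image n)) (M : Image n) : Prop :=
  ∀ N ∈ P, ε * (n : ℝ) ^ 2 ≤ (hammingDist M N : ℝ)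

/-- A deterministic nonadaptive algorithm: a set of pixels to query, fixed in advance, and a
decision (`true` = accept, `false` = reject) that depends only on the answers. -/
structure DetNonadaptive (n : ℕ) : Type where
  queries : Finset (Pixel n)
  decide : (queries → Bool) → Bool

/-- The output of a deterministic nonadaptive algorithm on the image `M`. -/
def DetNonadaptive.output {n : ℕ} (A : DetNonadaptive n) (M : Image n) : Bool :=
  A.decide (fun p => M p.1)

/-- A randomized nonadaptive algorithm: a probability distribution over deterministic ones
(there are only finitely many of these for given `n`). -/
abbrev RandNonadaptive (n : ℕ) : Type := PMF (DetNonadaptive n)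

/-- The distribution of the output of a randomized nonadaptive algorithm on the image `M`. -/
noncomputable def RandNonadaptive.outputLaw {n : ℕ} (T : RandNonadaptive n) (M : Image n) :
    PMF Bool :=
  PMF.map (fun A => A.output M) T

/-- `T` is a 1-sided error `ε`-tester for `P`: it always accepts the images in `P`, and it rejects
every image that is `ε`-far from `P` with probability at least `2/3`. -/
def RandNonadaptive.IsOneSidedTester {n : ℕ} (T : RandNonadaptive n) (ε : ℝ)
    (P : Set (Image n)) : Prop :=
  (∀ M ∈ P, T.outputLaw M true = 1) ∧ (∀ M, IsFar ε P M → 2 / 3 ≤ T.outputLaw M false)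

/-- For every outcome of its coins, `T` queries at most `q` pixels. -/
def RandNonadaptive.QueriesAtMost {n : ℕ} (T : RandNonadaptive n) (q : ℕ) : Prop :=
  ∀ A ∈ T.support, A.queries.card ≤ q

end ImageTesting

namespace ImageTesting

/-! A white grid of mesh r on a strip of an otherwise black image cuts off every cell it encloses,
so connecting the image costs a number of changes proportional to the number of cells
(`le_hammingDist_gridImage`). A one-sided algorithm may reject only if no connected image fits its
answers. If every vertical wall segment between two grid rows has an unqueried pixel, blackening
such pixels links all cells to the left edge (`openedGrid_connected`). Hence rejection needs r - 1
queries in a single wall column (`exists_column_of_reject`).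

Let r = 2^i run over a number of dyadic scales proportional to log(1/ε), and let the offset a run up
to n / 2. A strip with O(ε n r) walls already makes the image ε-far, so a column holding c queries
serves O(ε n r) offsets at each scale r ≤ c + 1, and by geometric summation O(ε n c) pairs (scale,
offset) in all. A deterministic algorithm thus rejects O(ε n q) of the pairs (`card_rejected_le`),
while on average it must reject two thirds of them (`card_mul_le_of_rejections`). -/

/-! ### Grid images and their distance from connectedness. -/

/-- The all-black image with a white grid of mesh `r` drawn on the strip of columns
`a ≤ x < a + 2 * m * r`, in the rows `y < 2 * h * r`. -/
def gridImage (n r m h a : ℕ) : Image n := fun p =>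
  !decide (a ≤ p.1.1 ∧ p.1.1 < a + 2 * m * r ∧ p.2.1 < 2 * h * r ∧ (r ∣ p.1.1 - a ∨ r ∣ p.2.1))

theorem gridImage_eq_true {n r m h a : ℕ} {p : Pixel n} :
    gridImage n r m h a p = true ↔
      ¬ (a ≤ p.1.1 ∧ p.1.1 < a + 2 * m * r ∧ p.2.1 < 2 * h * r ∧ (r ∣ p.1.1 - a ∨ r ∣ p.2.1)) := by
  simp only [gridImage, Bool.not_eq_true', decide_eq_false_iff_not]

theorem mem_of_connected {V : Type*} {G : SimpleGraph V} (hG : G.Connected) {S : Set V}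
    (hS : ∀ u ∈ S, ∀ v, G.Adj u v → v ∈ S) {u : V} (hu : u ∈ S) (v : V) : v ∈ S := by
  obtain ⟨w⟩ := hG.preconnected u v
  induction w with
  | nil => exact hu
  | cons hadj _ ih => exact ih (hS _ hu _ hadj)

theorem imageGraph_adj {n : ℕ} {M : Image n} {p p' : {p : Pixel n // M p = true}} :
    (imageGraph M).Adj p p' ↔
      |((p.1.1 : ℕ) : ℤ) - ((p'.1.1 : ℕ) : ℤ)| + |((p.1.2 : ℕ) : ℤ) - ((p'.1.2 : ℕ) : ℤ)| = 1 :=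
  Iff.rfl

theorem not_dvd_of_between {r k z : ℕ} (h₁ : k * r < z) (h₂ : z < k * r + r) : ¬ r ∣ z := by
  rintro ⟨c, rfl⟩
  have h3 : k < c := by
    by_contra hc
    have : r * c ≤ r * k := Nat.mul_le_mul_left r (by omega)
    nlinarith
  have : r * (k + 1) ≤ r * c := Nat.mul_le_mul_left r h3
  nlinarith

/-- The pixels strictly inside the grid cell with index `(2 * i, 2 * k)`. -/
def cellInterior (n r a i k : ℕ) : Set (Pixel n) :=
  {p | a + 2 * i * r < p.1.1 ∧ p.1.1 < a + 2 * i * r + r ∧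
    2 * k * r < p.2.1 ∧ p.2.1 < 2 * k * r + r}

/-- The index of the block of `2 × 2` grid cells containing a pixel. -/
def cellBlock {n : ℕ} (r a : ℕ) (p : Pixel n) : ℕ × ℕ :=
  ((p.1.1 - a) / (2 * r), p.2.1 / (2 * r))

theorem cellBlock_eq {n r a i k : ℕ} {p : Pixel n}
    (h₁ : a + 2 * i * r ≤ p.1.1) (h₂ : p.1.1 < a + 2 * i * r + 2 * r)
    (h₃ : 2 * k * r ≤ p.2.1) (h₄ : p.2.1 < 2 * k * r + 2 * r) : cellBlock r a p = (i, k) := by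
  unfold cellBlock
  have e₁ : 2 * i * r = i * (2 * r) := by ring
  have e₂ : 2 * k * r = k * (2 * r) := by ring
  rw [e₁] at h₁ h₂
  rw [e₂] at h₃ h₄
  refine Prod.ext (Nat.div_eq_of_lt_le ?_ ?_) (Nat.div_eq_of_lt_le ?_ ?_)
  · dsimp only; omega
  · dsimp only; rw [add_mul]; omega
  · exact h₃
  · dsimp only; rw [add_mul]; omega

theorem cell_bound {i m r : ℕ} (hi : i < m) : 2 * i * r + 2 * r ≤ 2 * m * r := by
  have : (2 * (i + 1)) * r ≤ 2 * m * r := Nat.mul_le_mul_right r (by omega)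
  linarith [this, show (2 * (i + 1)) * r = 2 * i * r + 2 * r by ring]

/-- If `N` agrees with the grid image on a cell with its frame, no black path leaves the cell. -/
theorem cellInterior_closed {n r m h a i k : ℕ} {N : Image n} (hr : 2 ≤ r)
    (hi : i < m) (hk : k < h)
    (hN : ∀ p, cellBlock r a p = (i, k) → gridImage n r m h a p = N p) {p p' : Pixel n}
    (hp : p ∈ cellInterior n r a i k) (hp' : N p' = true)
    (hadj : |((p.1 : ℕ) : ℤ) - ((p'.1 : ℕ) : ℤ)| + |((p.2 : ℕ) : ℤ) - ((p'.2 : ℕ) : ℤ)| = 1) :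
    p' ∈ cellInterior n r a i k := by
  obtain ⟨h₁, h₂, h₃, h₄⟩ := hp
  have b₁ := cell_bound (r := r) hi
  have b₂ := cell_bound (r := r) hk
  have d₁ : r ∣ 2 * i * r := Dvd.intro_left _ rfl
  have d₂ : r ∣ 2 * k * r := Dvd.intro_left _ rfl
  have d₃ : r ∣ 2 * i * r + r := (Nat.dvd_add_right d₁).2 dvd_rfl
  have d₄ : r ∣ 2 * k * r + r := (Nat.dvd_add_right d₂).2 dvd_rfl
  have hb : a + 2 * i * r ≤ p'.1.1 ∧ p'.1.1 ≤ a + 2 * i * r + r ∧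
      2 * k * r ≤ p'.2.1 ∧ p'.2.1 ≤ 2 * k * r + r := by
    generalize 2 * i * r = u at *
    generalize 2 * k * r = v at *
    grind
  obtain ⟨c₁, c₂, c₃, c₄⟩ := hb
  have hM := hN p' (cellBlock_eq c₁ (by omega) c₃ (by omega))
  rw [hp', gridImage_eq_true] at hM
  by_contra hcon
  apply hM
  refine ⟨by omega, by omega, by omega, ?_⟩
  have : p'.1.1 - a = 2 * i * r ∨ p'.1.1 - a = 2 * i * r + r ∨ p'.2.1 = 2 * k * r ∨
      p'.2.1 = 2 * k * r + r := by
    simp only [cellInterior, Set.mem_ofPred_eq] at hcon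
    omega
  rcases this with e | e | e | e <;> rw [e]
  · exact Or.inl d₁
  · exact Or.inl d₃
  · exact Or.inr d₂
  · exact Or.inr d₄

/-- Blocks of 2 × 2 cells are disjoint and each contains one cell with its whole frame, so a changed
pixel spoils only one block. Two unspoiled blocks would give two disjoint closed black regions,
impossible in a connected image; the one block that may survive is the `+ 1`. -/
theorem le_hammingDist_gridImage {n r m h a : ℕ} (hr : 2 ≤ r) (hm : a + 2 * m * r ≤ n)
    (hh : 2 * h * r ≤ n) {N : Image n} (hN : N ∈ connectedImages n) :
    m * h ≤ hammingDist (gridImage n r m h a) N + 1 := by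
  classical
  set D : Finset (Pixel n) := Finset.univ.filter fun p => gridImage n r m h a p ≠ N p with hD
  have hcard : ((Finset.range m ×ˢ Finset.range h) \ D.image (cellBlock r a)).card ≤ 1 := by
    rw [Finset.card_le_one]
    have key : ∀ c ∈ (Finset.range m ×ˢ Finset.range h) \ D.image (cellBlock r a),
        c.1 < m ∧ c.2 < h ∧
          (∀ p : Pixel n, cellBlock r a p = (c.1, c.2) → gridImage n r m h a p = N p) ∧
          ∃ p ∈ cellInterior n r a c.1 c.2, N p = true := by
      rintro ⟨i, k⟩ hc
      simp only [Finset.mem_sdiff, Finset.mem_product, Finset.mem_range, Finset.mem_image,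
        not_exists, not_and, hD, Finset.mem_filter, Finset.mem_univ, true_and] at hc
      obtain ⟨⟨hi, hk⟩, hc⟩ := hc
      have hag : ∀ p : Pixel n, cellBlock r a p = (i, k) → gridImage n r m h a p = N p :=
        fun p hp => by_contra fun hne => hc p hne hp
      refine ⟨hi, hk, hag, ?_⟩
      have b₁ := cell_bound (r := r) hi
      have b₂ := cell_bound (r := r) hk
      let p : Pixel n := (⟨a + 2 * i * r + 1, by omega⟩, ⟨2 * k * r + 1, by omega⟩)
      have hp : p ∈ cellInterior n r a i k := by
        simp only [cellInterior, Set.mem_ofPred_eq, p]; omega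
      refine ⟨p, hp, ?_⟩
      obtain ⟨h₁, h₂, h₃, h₄⟩ := hp
      rw [← hag p (cellBlock_eq (by omega) (by omega) (by omega) (by omega)), gridImage_eq_true]
      rintro ⟨-, -, -, hd | hd⟩
      · exact not_dvd_of_between (k := 2 * i) (by omega) (by omega) hd
      · exact not_dvd_of_between (k := 2 * k) (by omega) (by omega) hd
    intro c hc c' hc'
    obtain ⟨hi, hk, hag, p, hp, hNp⟩ := key c hc
    obtain ⟨-, -, -, p', hp', hNp'⟩ := key c' hc'
    have hmem : (⟨p', hNp'⟩ : {p : Pixel n // N p = true}) ∈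
        {q : {p : Pixel n // N p = true} | q.1 ∈ cellInterior n r a c.1 c.2} :=
      mem_of_connected (G := imageGraph N) hN
        (fun u hu v huv => cellInterior_closed hr hi hk hag hu v.2 huv) (u := ⟨p, hNp⟩) hp _
    obtain ⟨h₁, h₂, h₃, h₄⟩ := hp'
    obtain ⟨g₁, g₂, g₃, g₄⟩ : p' ∈ cellInterior n r a c.1 c.2 := hmem
    have e₁ := cellBlock_eq (p := p') h₁.le (by omega) h₃.le (by omega)
    have e₂ := cellBlock_eq (p := p') g₁.le (by omega) g₃.le (by omega)
    exact e₂.symm.trans e₁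
  have h1 : (Finset.range m ×ˢ Finset.range h).card ≤
      ((Finset.range m ×ˢ Finset.range h) \ D.image (cellBlock r a)).card +
        (D.image (cellBlock r a)).card := by
    rw [← Finset.card_sdiff_add_card_inter (Finset.range m ×ˢ Finset.range h)
      (D.image (cellBlock r a))]
    exact Nat.add_le_add_left (Finset.card_le_card Finset.inter_subset_right) _
  have h2 : (D.image (cellBlock r a)).card ≤ hammingDist (gridImage n r m h a) N :=
    Finset.card_image_le
  simp only [Finset.card_product, Finset.card_range] at h1
  omega

/-! ### Connected images that agree with the grid on the queries. -/

/-- The pixel with natural-number coordinates `x`, `y` exists and is black. -/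
def IsBlackAt {n : ℕ} (N : Image n) (x y : ℕ) : Prop :=
  ∃ p : Pixel n, p.1.1 = x ∧ p.2.1 = y ∧ N p = true

/-- The pixel with coordinates `x`, `y` is joined to `o` by a black path. -/
def ReachesAt {n : ℕ} (N : Image n) (o : {p : Pixel n // N p = true}) (x y : ℕ) : Prop :=
  ∃ p : {p : Pixel n // N p = true}, p.1.1.1 = x ∧ p.1.2.1 = y ∧ (imageGraph N).Reachable p o

section Reach

variable {n : ℕ} {N : Image n} {o : {p : Pixel n // N p = true}}

theorem ReachesAt.step {x y x' y' : ℕ} (h : ReachesAt N o x y) (hb : IsBlackAt N x' y')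
    (hadj : |(x' : ℤ) - (x : ℤ)| + |(y' : ℤ) - (y : ℤ)| = 1) : ReachesAt N o x' y' := by
  obtain ⟨p, rfl, rfl, hp⟩ := h
  obtain ⟨p', rfl, rfl, hp'⟩ := hb
  refine ⟨⟨p', hp'⟩, rfl, rfl, SimpleGraph.Reachable.trans (SimpleGraph.Adj.reachable ?_) hp⟩
  rw [imageGraph_adj]
  exact hadj

theorem ReachesAt.column {x y₀ lo hi : ℕ} (h : ReachesAt N o x y₀) (h₁ : lo ≤ y₀) (h₂ : y₀ < hi)
    (hb : ∀ z, lo ≤ z → z < hi → IsBlackAt N x z) {y : ℕ} (h₃ : lo ≤ y) (h₄ : y < hi) :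
    ReachesAt N o x y := by
  have up : ∀ d, y₀ + d < hi → ReachesAt N o x (y₀ + d) := by
    intro d
    induction d with
    | zero => exact fun _ => h
    | succ d ih =>
      intro hd
      refine (ih (by omega)).step (hb _ (by omega) hd) ?_
      push_cast; simp [← add_assoc]
  have down : ∀ d, lo + d ≤ y₀ → ReachesAt N o x (y₀ - d) := by
    intro d
    induction d with
    | zero => exact fun _ => h
    | succ d ih =>
      intro hd
      refine (ih (by omega)).step (hb _ (by omega) (by omega)) ?_
      rw [sub_self, abs_zero, zero_add, show ((y₀ - (d + 1) : ℕ) : ℤ) - ((y₀ - d : ℕ) : ℤ) = -1 by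
        omega]
      rfl
  rcases le_total y₀ y with hy | hy
  · have := up (y - y₀) (by omega)
    rwa [show y₀ + (y - y₀) = y by omega] at this
  · have := down (y₀ - y) (by omega)
    rwa [show y₀ - (y₀ - y) = y by omega] at this

end Reach

/-- The grid image with all the unqueried pixels of the vertical walls turned black. -/
def openedGrid {n : ℕ} (r m h a : ℕ) (Q : Finset (Pixel n)) : Image n := fun p =>
  gridImage n r m h a p || decide (p ∉ Q ∧ ¬ r ∣ p.2.1) && decide (r ∣ p.1.1 - a)

theorem openedGrid_eq_true {n r m h a : ℕ} {Q : Finset (Pixel n)} {p : Pixel n} :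
    openedGrid r m h a Q p = true ↔ gridImage n r m h a p = true ∨
      (p ∉ Q ∧ ¬ r ∣ p.2.1) ∧ r ∣ p.1.1 - a := by
  simp only [openedGrid, Bool.or_eq_true, Bool.and_eq_true, decide_eq_true_eq]

theorem openedGrid_eq_of_mem {n r m h a : ℕ} {Q : Finset (Pixel n)} {p : Pixel n} (hp : p ∈ Q) :
    openedGrid r m h a Q p = gridImage n r m h a p := by
  simp [openedGrid, hp]

/-- Induction on the column joins each black pixel to column 0, which is black because `1 ≤ a`: step
left, and if the left neighbour is white, first move vertically to a row where the step is free. -/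
theorem openedGrid_connected {n r m h a : ℕ} (hr : 2 ≤ r) (ha : 1 ≤ a)
    (hm : a + 2 * m * r ≤ n) (hh : 2 * h * r ≤ n) {Q : Finset (Pixel n)}
    (hQ : ∀ j k, j < 2 * m → k < 2 * h →
      ∃ p : Pixel n, p.1.1 = a + j * r ∧ k * r < p.2.1 ∧ p.2.1 < k * r + r ∧ p ∉ Q) :
    openedGrid r m h a Q ∈ connectedImages n := by
  set N := openedGrid r m h a Q with hN
  have black_of_not : ∀ x y, x < n → y < n →
      ¬ (a ≤ x ∧ x < a + 2 * m * r ∧ y < 2 * h * r ∧ (r ∣ x - a ∨ r ∣ y)) → IsBlackAt N x y :=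
    fun x y hx hy hxy => ⟨(⟨x, hx⟩, ⟨y, hy⟩), rfl, rfl,
      openedGrid_eq_true.2 (Or.inl (gridImage_eq_true.2 hxy))⟩
  have hn : 0 < n := by omega
  obtain ⟨o, ho1, ho2, ho⟩ := black_of_not 0 0 hn hn (by omega)
  have main : ∀ x y, IsBlackAt N x y → ReachesAt N ⟨o, ho⟩ x y := by
    intro x
    induction x with
    | zero =>
      rintro y ⟨p, -, rfl, -⟩
      have h0 : ReachesAt N ⟨o, ho⟩ 0 0 := ⟨⟨o, ho⟩, ho1, ho2, SimpleGraph.Reachable.refl _⟩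
      exact h0.column (lo := 0) (hi := n) le_rfl hn
        (fun z _ hz => black_of_not 0 z hn hz (by omega)) (Nat.zero_le _) p.2.2
    | succ x ih =>
      intro y hb
      by_cases hl : IsBlackAt N x y
      · refine (ih y hl).step hb ?_
        push_cast; simp
      obtain ⟨p, hpx, hpy, hp⟩ := id hb
      have hxn : x + 1 < n := hpx ▸ p.1.2
      have hyn : y < n := hpy ▸ p.2.2
      obtain ⟨g₁, g₂, g₃, g₄⟩ := not_not.1 fun hc => hl (black_of_not x y (by omega) hyn hc)
      have walls : ∀ z, r ∣ x - a → ¬ r ∣ z → z < n → IsBlackAt N (x + 1) z := by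
        intro z hx hz hzn
        refine black_of_not _ _ hxn hzn ?_
        rintro ⟨-, -, -, hd | hd⟩
        · rw [show x + 1 - a = (x - a) + 1 by omega, Nat.dvd_add_right hx] at hd
          have := Nat.le_of_dvd one_pos hd
          omega
        · exact hz hd
      by_cases hy : r ∣ y
      -- A horizontal wall blocks a leftward step only at its right end, just outside the strip; the
      -- row above the wall's index, `y + 1`, is then free.
      · have hend : ¬ x + 1 < a + 2 * m * r := by
          intro hlt
          rw [openedGrid_eq_true, gridImage_eq_true, hpx, hpy] at hp
          rcases hp with hp | hp
          · exact hp ⟨by omega, hlt, g₃, Or.inr hy⟩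
          · exact hp.1.2 hy
        have hy1 : ¬ r ∣ y + 1 := by
          rw [Nat.dvd_add_right hy]
          intro hd
          have := Nat.le_of_dvd one_pos hd
          omega
        have hx1 : ¬ r ∣ x - a := by
          intro hd
          have h2 : r ∣ (x - a) + 1 := by
            rw [show x - a + 1 = 2 * m * r by omega]
            exact Dvd.intro_left _ rfl
          rw [Nat.dvd_add_right hd] at h2
          have := Nat.le_of_dvd one_pos h2
          omega
        have hyn1 : y + 1 < n := by
          rcases Nat.lt_or_ge (y + 1) n with hlt | hge
          · exact hlt
          · exfalso
            apply hy1
            rw [show y + 1 = 2 * h * r by omega]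
            exact Dvd.intro_left _ rfl
        have s₁ := ih (y + 1) (black_of_not _ _ (by omega) hyn1 (by tauto))
        have s₂ := s₁.step (black_of_not (x + 1) (y + 1) hxn hyn1 (by tauto)) (by push_cast; simp)
        exact s₂.step hb (by push_cast; simp)
      -- Here a vertical wall blocks: slide along column `x + 1`, between two horizontal walls, to
      -- the opening given by `hQ`.
      · have hx : r ∣ x - a := g₄.resolve_right hy
        obtain ⟨j, hj⟩ := id hx
        have hr0 : 0 < r := by omega
        have hjm : j < 2 * m := by
          refine Nat.lt_of_mul_lt_mul_left (a := r) ?_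
          rw [← hj, mul_comm r]; omega
        have hkh : y / r < 2 * h := (Nat.div_lt_iff_lt_mul hr0).2 g₃
        obtain ⟨p', hp'x, hp'1, hp'2, hp'Q⟩ := hQ j (y / r) hjm hkh
        have hdm := Nat.div_add_mod y r
        have hml := Nat.mod_lt y hr0
        have hm0 : y % r ≠ 0 := fun h0 => hy (Nat.dvd_of_mod_eq_zero h0)
        rw [mul_comm r] at hdm
        have hxe : p'.1.1 = x := by rw [hp'x, mul_comm, ← hj]; omega
        have hbl : IsBlackAt N x p'.2.1 := ⟨p', hxe, rfl, openedGrid_eq_true.2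
          (Or.inr ⟨⟨hp'Q, not_dvd_of_between hp'1 hp'2⟩, hxe ▸ hx⟩)⟩
        have htop : y / r * r + r ≤ n := by
          have : (y / r + 1) * r ≤ 2 * h * r := Nat.mul_le_mul_right r hkh
          rw [add_mul, one_mul] at this
          omega
        have hcol : ∀ z, y / r * r + 1 ≤ z → z < y / r * r + r → IsBlackAt N (x + 1) z :=
          fun z hz1 hz2 => walls z hx (not_dvd_of_between hz1 hz2) (by omega)
        have s₁ := (ih _ hbl).step (hcol _ hp'1 hp'2) (by push_cast; simp)
        exact s₁.column hp'1 hp'2 hcol (by omega) (by omega)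
  have reach : ∀ p, (imageGraph N).Reachable p ⟨o, ho⟩ := by
    rintro ⟨p, hp⟩
    obtain ⟨p', h1, h2, h3⟩ := main p.1.1 p.2.1 ⟨p, rfl, rfl, hp⟩
    have : p' = ⟨p, hp⟩ := Subtype.ext (Prod.ext (Fin.ext h1) (Fin.ext h2))
    exact this ▸ h3
  have : Nonempty {p : Pixel n // N p = true} := ⟨⟨o, ho⟩⟩
  exact SimpleGraph.Connected.mk fun p p' => (reach p).trans (reach p').symm

/-! ### Counting the grid images that an algorithm can reject. -/

theorem output_eq_true_of_mem_support {n : ℕ} {T : RandNonadaptive n} {P : Set (Image n)}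
    (hT : ∀ M ∈ P, T.outputLaw M true = 1) {A : DetNonadaptive n} (hA : A ∈ T.support)
    {M : Image n} (hM : M ∈ P) : A.output M = true := by
  have hs := (PMF.apply_eq_one_iff _ _).1 (hT M hM)
  have : A.output M ∈ (T.outputLaw M).support := by
    rw [RandNonadaptive.outputLaw, PMF.support_map]
    exact ⟨A, hA, rfl⟩
  rw [hs] at this
  exact this

/-- If a tester rejects each image of a finite family with probability at least `2/3`, but each
deterministic algorithm in its support rejects at most `B` of them, the family is small. -/
theorem card_mul_le_of_rejections {n : ℕ} {ι : Type*} (T : RandNonadaptive n) (J : Finset ι)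
    (M : ι → Image n) (B : ENNReal) (hJ : ∀ j ∈ J, 2 / 3 ≤ T.outputLaw (M j) false)
    (hB : ∀ A ∈ T.support, ((J.filter fun j => A.output (M j) = false).card : ENNReal) ≤ B) :
    (J.card : ENNReal) * (2 / 3) ≤ B := by
  classical
  calc (J.card : ENNReal) * (2 / 3) = ∑ _j ∈ J, (2 / 3 : ENNReal) := by
        rw [Finset.sum_const, nsmul_eq_mul]
    _ ≤ ∑ j ∈ J, T.outputLaw (M j) false := Finset.sum_le_sum hJ
    _ = ∑ j ∈ J, ∑' A, T A * (if A.output (M j) = false then 1 else 0) := by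
        refine Finset.sum_congr rfl fun j _ => ?_
        rw [RandNonadaptive.outputLaw, PMF.map_apply]
        refine tsum_congr fun A => ?_
        by_cases h : A.output (M j) = false <;> simp [h]
    _ = ∑' A, ∑ j ∈ J, T A * (if A.output (M j) = false then 1 else 0) :=
        (Summable.tsum_finsetSum fun _ _ => ENNReal.summable).symm
    _ = ∑' A, T A * ((J.filter fun j => A.output (M j) = false).card : ENNReal) := by
        refine tsum_congr fun A => ?_
        rw [← Finset.mul_sum, Finset.sum_boole]
    _ ≤ ∑' A, T A * B := by
        refine ENNReal.tsum_le_tsum fun A => ?_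
        by_cases hA : A ∈ T.support
        · exact mul_le_mul_right (hB A hA) _
        · rw [PMF.mem_support_iff, not_not] at hA
          simp [hA]
    _ = B := by rw [ENNReal.tsum_mul_right, PMF.tsum_coe, one_mul]

/-- The number of pixels of `Q` in the column `x`. -/
def columnCount {n : ℕ} (Q : Finset (Pixel n)) (x : Fin n) : ℕ :=
  (Q.filter fun p => p.1 = x).card

theorem sum_columnCount {n : ℕ} (Q : Finset (Pixel n)) : ∑ x, columnCount Q x = Q.card :=
  (Finset.card_eq_sum_card_fiberwise fun _ _ => Finset.mem_coe.2 (Finset.mem_univ _)).symm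

/-- Otherwise `openedGrid` is connected and gives the same answers, so it would be rejected too. A
wall segment has `r - 1` inner pixels, whence the `+ 1`. -/
theorem exists_column_of_reject {n r m h a : ℕ} (hr : 2 ≤ r) (ha : 1 ≤ a)
    (hm : a + 2 * m * r ≤ n) (hh : 2 * h * r ≤ n) {A : DetNonadaptive n}
    (hA : ∀ N ∈ connectedImages n, A.output N = true)
    (hrej : A.output (gridImage n r m h a) = false) :
    ∃ x : Fin n, r ≤ columnCount A.queries x + 1 ∧ ∃ j < 2 * m, x.1 = a + j * r := by
  by_contra hcon
  push Not at hcon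
  have hQ : ∀ j k, j < 2 * m → k < 2 * h → ∃ p : Pixel n, p.1.1 = a + j * r ∧ k * r < p.2.1 ∧
      p.2.1 < k * r + r ∧ p ∉ A.queries := by
    intro j k hj hk
    by_contra hfull
    push Not at hfull
    have hjr : (j + 1) * r ≤ 2 * m * r := Nat.mul_le_mul_right r hj
    have hkr : (k + 1) * r ≤ 2 * h * r := Nat.mul_le_mul_right r hk
    rw [add_mul, one_mul] at hjr hkr
    let x : Fin n := ⟨a + j * r, by omega⟩
    refine hcon x ?_ j hj rfl
    have hcard : (Finset.Ioo (k * r) (k * r + r)).card ≤ columnCount A.queries x := by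
      refine Finset.card_le_card_of_surjOn (fun p : Pixel n => p.2.1) ?_
      intro y hy
      obtain ⟨h₁, h₂⟩ := Finset.mem_Ioo.1 (Finset.mem_coe.1 hy)
      have hyn : y < n := by omega
      exact ⟨(x, ⟨y, hyn⟩), Finset.mem_coe.2 (Finset.mem_filter.2
        ⟨hfull (x, ⟨y, hyn⟩) rfl h₁ h₂, rfl⟩), rfl⟩
    rw [Nat.card_Ioo] at hcard
    omega
  have htrue := hA _ (openedGrid_connected hr ha hm hh hQ)
  have : A.output (openedGrid r m h a A.queries) = A.output (gridImage n r m h a) :=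
    congrArg A.decide (funext fun p => openedGrid_eq_of_mem p.2)
  rw [this, hrej] at htrue
  exact Bool.false_ne_true htrue

/-- A heavily queried column `x` can only be a wall for the offsets `x - j * r` with `j < 2 * m`. -/
theorem card_rejected_offsets_le {n r m h s : ℕ} (hr : 2 ≤ r)
    (hm : s + 2 * m * r ≤ n) (hh : 2 * h * r ≤ n) {A : DetNonadaptive n}
    (hA : ∀ N ∈ connectedImages n, A.output N = true) :
    ((Finset.Icc 1 s).filter fun a => A.output (gridImage n r m h a) = false).card ≤
      ∑ x : Fin n, if r ≤ columnCount A.queries x + 1 then 2 * m else 0 := by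
  classical
  have hsub : ((Finset.Icc 1 s).filter fun a => A.output (gridImage n r m h a) = false) ⊆
      (Finset.univ.filter fun x : Fin n => r ≤ columnCount A.queries x + 1).biUnion
        fun x => (Finset.range (2 * m)).image fun j => x.1 - j * r := by
    intro a ha
    obtain ⟨ha, hrej⟩ := Finset.mem_filter.1 ha
    obtain ⟨h₁, h₂⟩ := Finset.mem_Icc.1 ha
    obtain ⟨x, hx, j, hj, hxj⟩ := exists_column_of_reject hr h₁ (by omega) hh hA hrej
    exact Finset.mem_biUnion.2 ⟨x, Finset.mem_filter.2 ⟨Finset.mem_univ _, hx⟩,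
      Finset.mem_image.2 ⟨j, Finset.mem_range.2 hj, by omega⟩⟩
  refine (Finset.card_le_card hsub).trans (Finset.card_biUnion_le.trans ?_)
  rw [Finset.sum_filter]
  refine Finset.sum_le_sum fun x _ => ?_
  split_ifs
  · exact Finset.card_image_le.trans (Finset.card_range _).le
  · exact le_rfl

/-- The geometric sum is less than `2 * (c + 1)`. For `c = 0` the scale `2 ^ 0` would still count,
so it is excluded. -/
theorem sum_two_pow_le {I : Finset ℕ} (hI : ∀ i ∈ I, 1 ≤ i) (c : ℕ) :
    ∑ i ∈ I, (if 2 ^ i ≤ c + 1 then 2 ^ i else 0) ≤ 4 * c := by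
  rw [← Finset.sum_filter]
  rcases Nat.eq_zero_or_pos c with rfl | hc
  · refine (Finset.sum_eq_zero fun i hi => ?_).le
    obtain ⟨h₁, h₂⟩ := Finset.mem_filter.1 hi
    have := Nat.pow_le_pow_right (n := 2) two_pos (hI i h₁)
    omega
  · have hsub : I.filter (fun i => 2 ^ i ≤ c + 1) ⊆ Finset.range (Nat.log 2 (c + 1) + 1) := by
      intro i hi
      have := Nat.le_log_of_pow_le one_lt_two (Finset.mem_filter.1 hi).2
      exact Finset.mem_range.2 (by omega)
    have h₁ := Finset.sum_le_sum_of_subset (f := fun i => 2 ^ i) hsub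
    have h₂ := Nat.geomSum_eq (m := 2) le_rfl (Nat.log 2 (c + 1) + 1)
    have h₃ := Nat.pow_log_le_self 2 (x := c + 1) (by omega)
    rw [pow_succ] at h₂
    omega

/-- Since `m i` is at most proportional to `2 ^ i`, exchanging the sums over scales and columns
charges each column a geometric sum, linear in its number of queries. -/
theorem card_rejected_le {n s : ℕ} {I : Finset ℕ} (hI : ∀ i ∈ I, 1 ≤ i) {m h : ℕ → ℕ} {K : ℝ}
    (hm : ∀ i ∈ I, s + 2 * m i * 2 ^ i ≤ n) (hh : ∀ i ∈ I, 2 * h i * 2 ^ i ≤ n)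
    (hmK : ∀ i ∈ I, (m i : ℝ) ≤ K * 2 ^ i) (hK : 0 ≤ K) {A : DetNonadaptive n}
    (hA : ∀ N ∈ connectedImages n, A.output N = true) :
    (((I ×ˢ Finset.Icc 1 s).filter fun j =>
      A.output (gridImage n (2 ^ j.1) (m j.1) (h j.1) j.2) = false).card : ℝ) ≤
      8 * K * A.queries.card := by
  have h₁ : ((I ×ˢ Finset.Icc 1 s).filter fun j =>
      A.output (gridImage n (2 ^ j.1) (m j.1) (h j.1) j.2) = false).card ≤
      ∑ i ∈ I, ∑ x : Fin n, if 2 ^ i ≤ columnCount A.queries x + 1 then 2 * m i else 0 := by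
    rw [Finset.card_filter, Finset.sum_product]
    refine Finset.sum_le_sum fun i hi => ?_
    rw [← Finset.card_filter]
    exact card_rejected_offsets_le
      (by simpa using Nat.pow_le_pow_right (n := 2) two_pos (hI i hi)) (hm i hi) (hh i hi) hA
  have h₂ : ∀ x : Fin n, (∑ i ∈ I, ((if 2 ^ i ≤ columnCount A.queries x + 1 then 2 * m i else 0 :
      ℕ) : ℝ)) ≤ 8 * K * columnCount A.queries x := by
    intro x
    have h₃ : ((∑ i ∈ I, (if 2 ^ i ≤ columnCount A.queries x + 1 then 2 ^ i else 0) : ℕ) : ℝ) ≤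
        ((4 * columnCount A.queries x : ℕ) : ℝ) := Nat.cast_le.2 (sum_two_pow_le hI _)
    calc _ ≤ ∑ i ∈ I, 2 * K *
          ((if 2 ^ i ≤ columnCount A.queries x + 1 then 2 ^ i else 0 : ℕ) : ℝ) := by
          refine Finset.sum_le_sum fun i hi => ?_
          split_ifs
          · have := hmK i hi
            push_cast
            linarith
          · simp
      _ ≤ 8 * K * columnCount A.queries x := by
          rw [← Finset.mul_sum, ← Nat.cast_sum]
          refine (mul_le_mul_of_nonneg_left h₃ (by positivity)).trans (le_of_eq ?_)
          push_cast
          ring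
  calc _ ≤ ((∑ i ∈ I, ∑ x : Fin n,
        if 2 ^ i ≤ columnCount A.queries x + 1 then 2 * m i else 0 : ℕ) : ℝ) := Nat.cast_le.2 h₁
    _ = ∑ x : Fin n, ∑ i ∈ I,
        ((if 2 ^ i ≤ columnCount A.queries x + 1 then 2 * m i else 0 : ℕ) : ℝ) := by
        rw [Nat.cast_sum, Finset.sum_comm]
        simp only [Nat.cast_sum]
    _ ≤ ∑ x : Fin n, 8 * K * columnCount A.queries x := Finset.sum_le_sum fun x _ => h₂ x
    _ = 8 * K * A.queries.card := by
        rw [← Finset.mul_sum, ← Nat.cast_sum, sum_columnCount]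

/-! ### Choice of parameters and conclusion. -/

/-- Mesh and strip sizes for which the grid image is far from connected; here `ε = t ^ (-8)`. -/
theorem grid_parameters {t : ℝ} (ht : 16 ≤ t) {n r : ℕ} (hn : t ^ 5 / 16 < n)
    (hr₁ : 2 * t ^ 3 ≤ r) (hr₂ : 16 * (r : ℝ) ≤ t ^ 4) :
    ∃ m h : ℕ, n / 2 + 2 * m * r ≤ n ∧ 2 * h * r ≤ n ∧ (m : ℝ) ≤ 16 * n / t ^ 8 * r ∧
      (n : ℝ) ^ 2 / t ^ 8 + 1 ≤ m * h := by
  have ht0 : 0 < t := by linarith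
  have hr0 : (0 : ℝ) < r := lt_of_lt_of_le (by positivity) hr₁
  have hn0 : (0 : ℝ) < n := lt_trans (by positivity) hn
  -- The lower bounds on `n` and `r` multiply to exactly `t ^ 8 / 8`; rounding up then at most
  -- doubles the value.
  have hone : 1 ≤ 8 * n * r / t ^ 8 := by
    rw [le_div_iff₀ (by positivity)]
    have := mul_le_mul hn.le hr₁ (by positivity) hn0.le
    nlinarith
  have hm₁ := Nat.le_ceil (8 * n * r / t ^ 8)
  have hm₂ := Nat.ceil_lt_add_one (show 0 ≤ 8 * n * r / t ^ 8 by linarith)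
  set m := ⌈8 * n * r / t ^ 8⌉₊
  have hm₃ : (m : ℝ) ≤ 16 * n / t ^ 8 * r := by
    have : 16 * n / t ^ 8 * r = 2 * (8 * n * r / t ^ 8) := by ring
    linarith
  -- The bound `16 * r ≤ t ^ 4` keeps the strip narrow enough to fit at every offset up to `n / 2`.
  have hmr : 2 * (m : ℝ) * r ≤ n / 8 := by
    calc 2 * (m : ℝ) * r ≤ 2 * (16 * n / t ^ 8 * r) * r := by gcongr
      _ = n / 8 * ((16 * r) ^ 2 / (t ^ 4) ^ 2) := by field_simp; norm_num
      _ ≤ n / 8 * 1 := by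
          refine mul_le_mul_of_nonneg_left ?_ (by positivity)
          rw [div_le_one (by positivity)]
          gcongr
      _ = n / 8 := mul_one _
  have hnr : 4 * (r : ℝ) ≤ n := by
    have : 16 * (t ^ 4 / 16) ≤ t * (t ^ 4 / 16) := by gcongr
    have h2 : t * (t ^ 4 / 16) = t ^ 5 / 16 := by ring
    linarith
  refine ⟨m, n / (2 * r), ?_, ?_, hm₃, ?_⟩
  · have : 2 * m * r * 8 ≤ n := by
      have : ((2 * m * r * 8 : ℕ) : ℝ) ≤ n := by push_cast; linarith
      exact_mod_cast this
    omega
  · have := Nat.div_mul_le_self n (2 * r)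
    calc _ = n / (2 * r) * (2 * r) := by ring
      _ ≤ n := this
  · have hh : (n : ℝ) ≤ 4 * r * (n / (2 * r) : ℕ) := by
      have h1 := Nat.lt_div_mul_add (a := n) (b := 2 * r) (by
        have : 0 < r := by exact_mod_cast hr0
        omega)
      have h2 : (n : ℝ) < (n / (2 * r) : ℕ) * (2 * r) + 2 * r := by exact_mod_cast h1
      linarith
    -- The factor 2 in `hprod` exceeds what is needed by at least 1, which pays for the surviving
    -- block.
    have hbig : 1 ≤ (n : ℝ) ^ 2 / t ^ 8 := by
      rw [one_le_div (by positivity)]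
      calc t ^ 8 = t ^ 8 * 1 := (mul_one _).symm
        _ ≤ t ^ 8 * (t / 16) ^ 2 := by
            refine mul_le_mul_of_nonneg_left (one_le_pow₀ ?_) (by positivity)
            linarith
        _ = (t ^ 5 / 16) ^ 2 := by ring
        _ ≤ (n : ℝ) ^ 2 := by gcongr
    have hprod : 2 * ((n : ℝ) ^ 2 / t ^ 8) ≤ m * (n / (2 * r) : ℕ) := by
      calc 2 * ((n : ℝ) ^ 2 / t ^ 8) = 2 * n / t ^ 8 * n := by ring
        _ ≤ 2 * n / t ^ 8 * (4 * r * (n / (2 * r) : ℕ)) := by gcongr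
        _ = 8 * n * r / t ^ 8 * (n / (2 * r) : ℕ) := by ring
        _ ≤ m * (n / (2 * r) : ℕ) := by gcongr
    linarith

end ImageTesting

open ImageTesting

theorem theorem2 :
    ∃ c : ℝ, 0 < c ∧ ∃ ε₀ : ℝ, 0 < ε₀ ∧ ε₀ < 1 ∧
      ∀ ε : ℝ, 0 < ε → ε ≤ ε₀ →
        ∀ n : ℕ, (1 / 16 : ℝ) * (1 / ε) ^ (5 / 8 : ℝ) < (n : ℝ) →
          ∀ T : ImageTesting.RandNonadaptive n,
            ImageTesting.RandNonadaptive.IsOneSidedTester T ε (ImageTesting.connectedImages n) →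
              ∀ q : ℕ, ImageTesting.RandNonadaptive.QueriesAtMost T q →
                c * (1 / ε) * Real.logb 2 (1 / ε) ≤ (q : ℝ) := by
  -- 9216 = (8 · 16) · (16 · 3 · 3/2): the first factor is from the rejection count, the second from
  -- `hIcard`, `hhalf` and the probability 2/3.
  refine ⟨1 / 9216, by norm_num, 1 / 2 ^ 96, by norm_num, by norm_num, ?_⟩
  intro ε hε hε₀ n hn T hT q hq
  set ℓ := Real.logb 2 (1 / ε) with hℓ
  have hℓ96 : 96 ≤ ℓ := by
    rw [hℓ, Real.le_logb_iff_rpow_le one_lt_two (by positivity), le_one_div (by positivity) hε]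
    exact_mod_cast hε₀
  have hpow : (2 : ℝ) ^ ℓ = 1 / ε := Real.rpow_logb two_pos (by norm_num) (by positivity)
  set t : ℝ := 2 ^ (ℓ / 8) with ht
  have ht0 : 0 < t := Real.rpow_pos_of_pos two_pos _
  have htk : ∀ k : ℕ, t ^ k = 2 ^ (ℓ / 8 * k) := fun k => by
    rw [ht, ← Real.rpow_natCast, ← Real.rpow_mul zero_le_two]
  have ht8 : t ^ 8 = 1 / ε := by
    rw [htk, ← hpow]; congr 1; push_cast; ring
  have hε8 : ε = 1 / t ^ 8 := by rw [ht8, one_div_one_div]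
  have ht16 : 16 ≤ t := by
    calc (16 : ℝ) = 2 ^ (4 : ℝ) := by norm_num
      _ ≤ t := Real.rpow_le_rpow_of_exponent_le one_le_two (by linarith)
  have hn' : t ^ 5 / 16 < n := by
    refine lt_of_le_of_lt (le_of_eq ?_) hn
    rw [← hpow, ← Real.rpow_mul zero_le_two, htk, div_eq_mul_one_div, mul_comm]
    congr 2; push_cast; ring
  -- These are the `i` with `2 * t ^ 3 ≤ 2 ^ i ≤ t ^ 4 / 16`. There are more than `ℓ / 8 - 6` of
  -- them, and this is at least `ℓ / 16` once `96 ≤ ℓ`, which fixes the threshold for `ε`.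
  set I := Finset.Icc ⌈3 * ℓ / 8 + 1⌉₊ ⌊ℓ / 2 - 4⌋₊ with hI
  have hIcard : ℓ / 16 ≤ (I.card : ℝ) := by
    have h₁ := Nat.ceil_lt_add_one (show 0 ≤ 3 * ℓ / 8 + 1 by linarith)
    have h₂ := Nat.lt_floor_add_one (ℓ / 2 - 4)
    have h₃ : (⌊ℓ / 2 - 4⌋₊ + 1 : ℝ) ≤ I.card + ⌈3 * ℓ / 8 + 1⌉₊ := by
      rw [hI, Nat.card_Icc]
      exact_mod_cast le_tsub_add
    linarith
  have hI1 : ∀ i ∈ I, 1 ≤ i := fun i hi =>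
    (Nat.one_le_ceil_iff.2 (by linarith)).trans (Finset.mem_Icc.1 hi).1
  have hpar : ∀ i, ∃ m h : ℕ, i ∈ I → n / 2 + 2 * m * 2 ^ i ≤ n ∧ 2 * h * 2 ^ i ≤ n ∧
      (m : ℝ) ≤ 16 * n / t ^ 8 * 2 ^ i ∧ (n : ℝ) ^ 2 / t ^ 8 + 1 ≤ m * h := by
    intro i
    by_cases hi : i ∈ I
    · obtain ⟨h₁, h₂⟩ := Finset.mem_Icc.1 hi
      have h₁ : 3 * ℓ / 8 + 1 ≤ i := Nat.ceil_le.1 h₁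
      have h₂ : (i : ℝ) ≤ ℓ / 2 - 4 := (Nat.le_floor_iff (by linarith)).1 h₂
      have hcast : ((2 ^ i : ℕ) : ℝ) = 2 ^ (i : ℝ) := by rw [Real.rpow_natCast]; push_cast; rfl
      obtain ⟨m, h, hmh⟩ := grid_parameters ht16 hn' (r := 2 ^ i)
        (by
          rw [hcast, htk]
          calc (2 : ℝ) * 2 ^ (ℓ / 8 * (3 : ℕ)) = 2 ^ (1 + ℓ / 8 * (3 : ℕ)) := by
                rw [Real.rpow_add two_pos, Real.rpow_one]
            _ ≤ _ := Real.rpow_le_rpow_of_exponent_le one_le_two (by push_cast; linarith))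
        (by
          rw [hcast, htk]
          calc (16 : ℝ) * 2 ^ (i : ℝ) = 2 ^ (4 + (i : ℝ)) := by
                rw [Real.rpow_add two_pos]; norm_num
            _ ≤ _ := Real.rpow_le_rpow_of_exponent_le one_le_two (by push_cast; linarith))
      push_cast at hmh
      exact ⟨m, h, fun _ => hmh⟩
    · exact ⟨0, 0, fun h => absurd h hi⟩
  choose m h hmh using hpar
  have hcount := card_mul_le_of_rejections T (I ×ˢ Finset.Icc 1 (n / 2))
    (fun j => gridImage n (2 ^ j.1) (m j.1) (h j.1) j.2)
    (ENNReal.ofReal (8 * (16 * n / t ^ 8) * q)) (by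
      rintro ⟨i, a⟩ hj
      obtain ⟨hi, ha⟩ := Finset.mem_product.1 hj
      obtain ⟨p₁, p₂, p₃, p₄⟩ := hmh i hi
      have ha := (Finset.mem_Icc.1 ha).2
      refine hT.2 _ fun N hN => ?_
      have hr : 2 ≤ 2 ^ i := by simpa using Nat.pow_le_pow_right (n := 2) two_pos (hI1 i hi)
      have hd : ((m i * h i : ℕ) : ℝ) ≤ _ := Nat.cast_le.2
        (le_hammingDist_gridImage (a := a) hr (by dsimp only at ha; omega) p₂ hN)
      push_cast at hd
      have : ε * (n : ℝ) ^ 2 = (n : ℝ) ^ 2 / t ^ 8 := by rw [hε8]; ring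
      linarith) (by
      intro A hA
      rw [← ENNReal.ofReal_natCast]
      refine ENNReal.ofReal_le_ofReal ((card_rejected_le hI1 (fun i hi => (hmh i hi).1)
        (fun i hi => (hmh i hi).2.1) (fun i hi => (hmh i hi).2.2.1) (by positivity)
        fun N hN => output_eq_true_of_mem_support hT.1 hA hN).trans ?_)
      have : (A.queries.card : ℝ) ≤ q := Nat.cast_le.2 (hq A hA)
      gcongr)
  have hreal : (I.card : ℝ) * (n / 2 : ℕ) * (2 / 3) ≤ 8 * (16 * n / t ^ 8) * q := by
    rw [← ENNReal.ofReal_le_ofReal_iff (by positivity)]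
    refine le_trans (le_of_eq ?_) hcount
    rw [Finset.card_product, Nat.card_Icc 1, Nat.add_sub_cancel,
      ENNReal.ofReal_mul (mul_nonneg (Nat.cast_nonneg _) (Nat.cast_nonneg _)), ← Nat.cast_mul,
      ENNReal.ofReal_natCast, ENNReal.ofReal_div_of_pos (by norm_num)]
    norm_num
  have hn3 : (3 : ℝ) < n := by
    have : (16 : ℝ) ^ 5 / 16 ≤ t ^ 5 / 16 := by gcongr
    norm_num at this
    linarith
  have hhalf : (n : ℝ) / 3 ≤ (n / 2 : ℕ) := by
    have h₁ : 3 < n := by exact_mod_cast hn3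
    have h₂ : n ≤ 3 * (n / 2) := by omega
    have h₃ : (n : ℝ) ≤ 3 * (n / 2 : ℕ) := by exact_mod_cast h₂
    linarith
  have hfin : ℓ / 16 * (n / 3) * (2 / 3) ≤ 8 * (16 * n / t ^ 8) * q := by
    refine le_trans (mul_le_mul_of_nonneg_right ?_ (by norm_num)) hreal
    exact mul_le_mul hIcard hhalf (by positivity) (Nat.cast_nonneg _)
  rw [← ht8]
  have hn0 : (0 : ℝ) < n := by linarith
  have e : 8 * (16 * (n : ℝ) / t ^ 8) * q = 128 * n * q / t ^ 8 := by ring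
  rw [e, le_div_iff₀ (by positivity)] at hfin
  refine le_of_mul_le_mul_left ?_ hn0
  linarith
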